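/- For a positive integer $n$ let $\mathbb{Z}_n=\mathbb{Z}/n\mathbb{Z}$, identified with $\{1,2,\dots,n\}$, and let $e_n(x)=e^{2\pi i x/n}$. Let $P:\mathbb{Z}_n\to\{0,1\}$ be the characteristic function of the primes in $\{1,\dots,n\}$, let $P_-(x)=P(-x)$, and let $$\hat P(\xi)=\sum_{x\in\mathbb{Z}_n}P(x)\,e_n(-\xi x),\qquad (f*g)(x)=\sum_{y\in\mathbb{Z}_n}f(y)\,g(x-y).$$ For positive integers $k,n$ put $\pi_{2k}(n):=(P*P_-)(-2k)$, the number of $x\in\mathbb{Z}_n$ with $P(x)=P(x+2k)=1$, where $x+2k$ is taken modulo $n$. Theorem. Let $k$ be a positive integer. For every positive integer $n$, $$\pi_{2k}(n)=\frac1n\sum_{\xi\in\mathbb{Z}_n}|\hat P(\xi)|^2\,e_n(-2k\xi).$$ In particular, for fixed $k$, $$\pi_{2k}(n)=\frac{n}{\log^2 n}+\frac1n\sum_{\xi\in\mathbb{Z}_n\setminus\{0\}}|\hat P(\xi)|^2\,e_n(-2k\xi)+o\!\left(\frac{n}{\log^2 n}\right),\qquad n\to\infty.$$ Moreover, for fixed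 $k$, the ordinary count $|\{p\le n:\ p\text{ and }p+2k\text{ both prime}\}|$ differs from $\pi_{2k}(n)$ by $O(1)$ as $n\to\infty$, and therefore satisfies the same asymptotic formula. -/

import Mathlib

namespace PrimePairs

/-- The number of primes `p ≤ n` such that `p + 2k` is also prime. -/
def primePairCount (k n : ℕ) : ℕ :=
  ((Finset.Icc 1 n).filter fun p => p.Prime ∧ (p + 2 * k).Prime).card

/-- The representative in `{1, 2, …, n}` of a residue class modulo `n`
(so the class `0` is represented by `n`). -/
def rep (n : ℕ) (x : ZMod n) : ℕ :=
  if x = 0 then n else x.val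

theorem rep_mem (n : ℕ) [NeZero n] (x : ZMod n) : rep n x ∈ Finset.Icc 1 n := by
  have hn := NeZero.pos n
  unfold rep
  split_ifs with h
  · exact Finset.mem_Icc.2 ⟨hn, le_rfl⟩
  · have h0 : x.val ≠ 0 := fun h' => h ((ZMod.val_eq_zero x).1 h')
    exact Finset.mem_Icc.2 ⟨Nat.one_le_iff_ne_zero.2 h0, (ZMod.val_lt x).le⟩

theorem rep_cast (n : ℕ) [NeZero n] (x : ZMod n) : ((rep n x : ℕ) : ZMod n) = x := by
  unfold rep
  split_ifs with h
  · simp [h]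
  · simp

/-- The characteristic function `P` of the primes in `{1, 2, …, n}`, as a function on
`ℤ/nℤ` identified with `{1, 2, …, n}`. -/
noncomputable def primeInd (n : ℕ) (x : ZMod n) : ℂ :=
  if (rep n x).Prime then 1 else 0

/-- Convolution `(f ∗ g)(x) = ∑ y, f y * g (x - y)` on `ℤ/nℤ`. -/
noncomputable def conv {n : ℕ} [NeZero n] (f g : ZMod n → ℂ) (x : ZMod n) : ℂ :=
  ∑ y : ZMod n, f y * g (x - y)

/-- The cyclic prime pair count `(P ∗ P₋)(-2k)`, where `P₋ x = P (-x)`. -/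
noncomputable def cyclicPairCount (k n : ℕ) [NeZero n] : ℂ :=
  conv (primeInd n) (fun x => primeInd n (-x)) (-(2 * (k : ZMod n)))

/-- The discrete Fourier transform of `P`,
`P̂(ξ) = ∑ x, P(x) e_n(-ξ x)` with `e_n(x) = exp (2 π i x / n)`. -/
noncomputable def primeHat (n : ℕ) [NeZero n] (ξ : ZMod n) : ℂ :=
  ZMod.dft (primeInd n) ξ

/-- The term `|P̂(ξ)|² e_n(-2kξ)`; Mathlib's `ZMod.stdAddChar` is the character `e_n`. -/
noncomputable def spectralTerm (k n : ℕ) [NeZero n] (ξ : ZMod n) : ℂ :=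
  (‖primeHat n ξ‖ : ℂ) ^ 2 * ZMod.stdAddChar (-(2 * (k : ZMod n) * ξ))

end PrimePairs

/-! The exact identity is Wiener–Khinchin on `ZMod n`: the count is an autocorrelation of `P`, so
Fourier inversion of `|P̂|²` returns it (`sum_norm_dft_sq_mul_stdAddChar`). The zero frequency
contributes `π(n)²/n`, which the prime number theorem turns into `n/log² n + o(n/log² n)`. Reduction
modulo `n` affects only the primes `p > n - 2k`, so the ordinary count differs by at most `2k`,
which is negligible.

The prime number theorem comes from a Wiener–Ikehara argument. The Laplace transform of `e^{-u}
ψ(e^u) - 1` extends continuously to `Re z ≥ 0`, because `-ζ'/ζ` has only its pole at `1` on `Re s ≥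
1`. Averaging against a Fejér kernel and applying Riemann–Lebesgue shows that local averages of
`e^{-u} ψ(e^u)` tend to `1`; monotonicity of `ψ` upgrades this to pointwise convergence
(`tendsto_one_of_laplace`). -/

/-! ### A Tauberian theorem of Wiener–Ikehara type. -/

namespace WienerIkehara

open Filter Topology MeasureTheory Set

/-- Half of the Fejér kernel, as the cosine transform of a triangle. -/
noncomputable def fejer (v : ℝ) : ℝ := ∫ t in (0 : ℝ)..1, (1 - t) * Real.cos (t * v)

theorem fejer_eq {v : ℝ} (hv : v ≠ 0) : fejer v = (1 - Real.cos v) / v ^ 2 := by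
  have h : ∀ t ∈ uIcc (0 : ℝ) 1, HasDerivAt
      (fun t => (1 - t) * Real.sin (t * v) / v - Real.cos (t * v) / v ^ 2)
      ((1 - t) * Real.cos (t * v)) t := by
    intro t _
    have h1 : HasDerivAt (fun t : ℝ => t * v) v t := by simpa using (hasDerivAt_id t).mul_const v
    have h2 : HasDerivAt (fun t : ℝ => 1 - t) (-1) t := by
      simpa using (hasDerivAt_id t).const_sub 1
    refine (((h2.mul h1.sin).div_const v).sub (h1.cos.div_const (v ^ 2))).congr_deriv ?_
    field
  rw [fejer, intervalIntegral.integral_eq_sub_of_hasDerivAt h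
    (Continuous.intervalIntegrable (by fun_prop) _ _)]
  simp
  ring

theorem fejer_zero : fejer 0 = 1 / 2 := by
  have h : ∀ t ∈ uIcc (0 : ℝ) 1, HasDerivAt (fun t : ℝ => t - t ^ 2 / 2) (1 - t) t := by
    intro t _
    refine ((hasDerivAt_id t).sub (((hasDerivAt_id t).pow 2).div_const 2)).congr_deriv ?_
    simp
  simp only [fejer, mul_zero, Real.cos_zero, mul_one]
  rw [intervalIntegral.integral_eq_sub_of_hasDerivAt h
    (Continuous.intervalIntegrable (by fun_prop) _ _)]
  norm_num

theorem continuous_fejer : Continuous fejer := by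
  unfold fejer
  exact intervalIntegral.continuous_parametric_intervalIntegral_of_continuous'
    (by fun_prop) _ _

theorem fejer_nonneg (v : ℝ) : 0 ≤ fejer v := by
  rcases eq_or_ne v 0 with rfl | hv
  · rw [fejer_zero]; norm_num
  · rw [fejer_eq hv]
    have := Real.cos_le_one v
    exact div_nonneg (by linarith) (sq_nonneg v)

theorem fejer_le (v : ℝ) : fejer v ≤ 3 * (1 + v ^ 2)⁻¹ := by
  rcases eq_or_ne v 0 with rfl | hv
  · rw [fejer_zero]; norm_num
  · rw [fejer_eq hv, ← div_eq_mul_inv, div_le_div_iff₀ (by positivity) (by positivity)]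
    have h1 := Real.neg_one_le_cos v
    have h2 := Real.one_sub_sq_div_two_le_cos (x := v)
    -- Since `1 - cos v` is at most both `v²/2` and `2`, even the constant `5/2` would do.
    nlinarith [sq_nonneg v, mul_nonneg (sq_nonneg v) (by linarith : 0 ≤ 1 + Real.cos v)]

theorem integrable_fejer : Integrable fejer := by
  refine (integrable_inv_one_add_sq.const_mul 3).mono' continuous_fejer.aestronglyMeasurable
    (ae_of_all _ fun v => ?_)
  rw [Real.norm_of_nonneg (fejer_nonneg v)]
  exact fejer_le v

theorem integral_fejer_pos : 0 < ∫ v, fejer v :=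
  integral_pos_of_integrable_nonneg_nonzero (x := 0)
    continuous_fejer integrable_fejer fejer_nonneg (by rw [fejer_zero]; norm_num)

theorem integrable_fejer_comp {l : ℝ} (hl : 0 < l) (y : ℝ) :
    Integrable fun u => fejer (l * (y - u)) :=
  ((integrable_fejer.comp_mul_left' hl.ne').comp_sub_left y)

/-- The real form of Parseval's identity for a Laplace transform against the Fejér kernel. -/
theorem integral_mul_exp_mul_fejer {h : ℝ → ℝ} {C : ℝ} (hm : Measurable h)
    (hC : ∀ u, |h u| ≤ C) {G : ℂ → ℂ}
    (hG : ∀ z : ℂ, 0 < z.re → ∫ u in Ioi (0 : ℝ), (h u : ℂ) * Complex.exp (-z * u) = G z)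
    {ε : ℝ} (hε : 0 < ε) (l y : ℝ) :
    ∫ u in Ioi (0 : ℝ), h u * Real.exp (-ε * u) * fejer (l * (y - u)) =
      (∫ t in (0 : ℝ)..1, (1 - t : ℂ) * Complex.exp (l * t * y * Complex.I) *
        G (ε + l * t * Complex.I)).re := by
  set F : ℝ → ℝ → ℂ := fun u t => (h u * Real.exp (-ε * u) : ℝ) *
    ((1 - t : ℝ) * Complex.exp ((l * t * (y - u) : ℝ) * Complex.I)) with hF
  have hint : IntegrableOn (fun u => h u * Real.exp (-ε * u)) (Ioi 0) := by
    refine ((exp_neg_integrableOn_Ioi 0 hε).const_mul C).mono' (by fun_prop)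
      (ae_of_all _ fun u => ?_)
    rw [norm_mul, Real.norm_eq_abs, Real.norm_of_nonneg (Real.exp_nonneg _)]
    exact mul_le_mul_of_nonneg_right (hC u) (Real.exp_nonneg _)
  -- The damping `exp (-ε u)` gives absolute integrability on the half-line, which licenses Fubini.
  have hprod : Integrable (Function.uncurry F)
      ((volume.restrict (Ioi 0)).prod (volume.restrict (Ioc 0 1))) := by
    have h1 : Integrable (fun p : ℝ × ℝ => ((h p.1 * Real.exp (-ε * p.1) : ℝ) : ℂ) * (1 : ℂ))
      ((volume.restrict (Ioi 0)).prod (volume.restrict (Ioc (0 : ℝ) 1))) :=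
      Integrable.mul_prod (f := fun u : ℝ => ((h u * Real.exp (-ε * u) : ℝ) : ℂ))
        (g := fun _ => (1 : ℂ)) hint.ofReal (integrable_const _)
    refine h1.mono (by simp only [hF, Function.uncurry_def]; fun_prop) ?_
    have hs : ∀ᵐ p ∂((volume.restrict (Ioi (0 : ℝ))).prod (volume.restrict (Ioc (0 : ℝ) 1))),
        p.2 ∈ Ioc (0 : ℝ) 1 := by
      rw [Measure.prod_restrict]
      filter_upwards [ae_restrict_mem (measurableSet_Ioi.prod measurableSet_Ioc)] with p hp
      exact hp.2
    filter_upwards [hs] with p hp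
    simp only [hF, Function.uncurry_def, norm_mul, Complex.norm_exp_ofReal_mul_I, norm_one]
    gcongr
    rw [mul_one, Complex.norm_real, Real.norm_of_nonneg (by linarith [hp.2])]
    linarith [hp.1]
  have hre : ∀ u, h u * Real.exp (-ε * u) * fejer (l * (y - u)) =
      (∫ t in Ioc (0 : ℝ) 1, F u t).re := by
    intro u
    have hi : Integrable (F u) (volume.restrict (Ioc 0 1)) :=
      (Continuous.integrableOn_Icc (by simp only [hF]; fun_prop)).mono_set Ioc_subset_Icc_self
    rw [fejer, intervalIntegral.integral_of_le zero_le_one, ← integral_const_mul]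
    have h3 := integral_re hi
    simp only [RCLike.re_eq_complex_re] at h3
    rw [← h3]
    refine integral_congr_ae (ae_of_all _ fun t => ?_)
    simp only [hF]
    rw [Complex.re_ofReal_mul, Complex.re_ofReal_mul, Complex.exp_ofReal_mul_I_re]
    ring_nf
  simp_rw [hre]
  have h2 := integral_re hprod.integral_prod_left
  simp only [RCLike.re_eq_complex_re] at h2
  change ∫ u in Ioi 0, (∫ t in Ioc 0 1, Function.uncurry F (u, t)).re = _
  rw [h2]
  simp only [Function.uncurry_apply_pair]
  rw [integral_integral_swap hprod, intervalIntegral.integral_of_le zero_le_one]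
  congr 1
  refine integral_congr_ae (ae_of_all _ fun t => ?_)
  simp only [hF]
  rw [← hG _ (by simpa using hε), ← integral_const_mul]
  refine integral_congr_ae (ae_of_all _ fun u => ?_)
  simp only
  push_cast
  have : Complex.exp (l * t * (y - u) * Complex.I) * Complex.exp (-ε * u) =
      Complex.exp (l * t * y * Complex.I) * Complex.exp (-(ε + l * t * Complex.I) * u) := by
    rw [← Complex.exp_add, ← Complex.exp_add]; ring_nf
  linear_combination (h u : ℂ) * (1 - t) * this

/-- Let `ε → 0⁺` in the damped identity. The left side is dominated by `C` times the kernel, the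
right side by the maximum of `‖G‖` on a compact rectangle touching the imaginary axis. -/
theorem integral_mul_fejer_eq {h : ℝ → ℝ} {C : ℝ} (hm : Measurable h)
    (hC : ∀ u, |h u| ≤ C) {G : ℂ → ℂ} (hGc : ContinuousOn G {z | 0 ≤ z.re})
    (hG : ∀ z : ℂ, 0 < z.re → ∫ u in Ioi (0 : ℝ), (h u : ℂ) * Complex.exp (-z * u) = G z)
    {l : ℝ} (hl : 0 < l) (y : ℝ) :
    ∫ u in Ioi (0 : ℝ), h u * fejer (l * (y - u)) =
      (∫ t in (0 : ℝ)..1, (1 - t : ℂ) * Complex.exp (l * t * y * Complex.I) *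
        G (l * t * Complex.I)).re := by
  have hC0 : 0 ≤ C := (abs_nonneg _).trans (hC 0)
  have hL : Tendsto (fun ε : ℝ => ∫ u in Ioi (0 : ℝ), h u * Real.exp (-ε * u) *
      fejer (l * (y - u))) (𝓝[>] 0) (𝓝 (∫ u in Ioi (0 : ℝ), h u * fejer (l * (y - u)))) := by
    refine tendsto_integral_filter_of_dominated_convergence
      (fun u => C * fejer (l * (y - u))) ?_ ?_
      ((integrable_fejer_comp hl y).const_mul C).integrableOn ?_
    · have := continuous_fejer.measurable
      exact Eventually.of_forall fun ε => by fun_prop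
    · filter_upwards [self_mem_nhdsWithin] with ε hε
      filter_upwards [ae_restrict_mem measurableSet_Ioi] with u hu
      rw [norm_mul, norm_mul, Real.norm_eq_abs, Real.norm_of_nonneg (Real.exp_nonneg _),
        Real.norm_of_nonneg (fejer_nonneg _)]
      refine mul_le_mul_of_nonneg_right ?_ (fejer_nonneg _)
      have h1 : Real.exp (-ε * u) ≤ 1 := by
        rw [Real.exp_le_one_iff]
        have := mul_pos (mem_Ioi.1 hε) (mem_Ioi.1 hu)
        linarith
      simpa using mul_le_mul (hC u) h1 (Real.exp_nonneg _) hC0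
    · refine ae_of_all _ fun u => ?_
      have : Continuous fun ε : ℝ => h u * Real.exp (-ε * u) * fejer (l * (y - u)) := by fun_prop
      simpa using (this.tendsto 0).mono_left nhdsWithin_le_nhds
  have hcomp : IsCompact (Icc (0 : ℝ) 1 ×ℂ Icc 0 l) := isCompact_Icc.reProdIm isCompact_Icc
  obtain ⟨M, hM⟩ := hcomp.exists_bound_of_continuousOn
    (hGc.mono fun z hz => ((Complex.mem_reProdIm.1 hz).1).1)
  have hcont : ∀ ε : ℝ, 0 ≤ ε → ContinuousOn (fun t : ℝ => G (ε + l * t * Complex.I)) univ := by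
    intro ε hε
    exact hGc.comp (by fun_prop) fun t _ => by simpa using hε
  have hR : Tendsto (fun ε : ℝ => ∫ t in (0 : ℝ)..1, (1 - t : ℂ) *
      Complex.exp (l * t * y * Complex.I) * G (ε + l * t * Complex.I)) (𝓝[>] 0)
      (𝓝 (∫ t in (0 : ℝ)..1, (1 - t : ℂ) * Complex.exp (l * t * y * Complex.I) *
        G (l * t * Complex.I))) := by
    refine intervalIntegral.tendsto_integral_filter_of_dominated_convergence (fun _ => M) ?_ ?_
      intervalIntegrable_const ?_
    · filter_upwards [self_mem_nhdsWithin] with ε hε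
      have := continuousOn_univ.1 (hcont ε (mem_Ioi.1 hε).le)
      exact (Continuous.mul (by fun_prop) this).aestronglyMeasurable
    · filter_upwards [Ioo_mem_nhdsGT (zero_lt_one' ℝ)] with ε hε
      refine ae_of_all _ fun t ht => ?_
      rw [uIoc_of_le zero_le_one] at ht
      have h1 : ‖(1 - t : ℂ)‖ ≤ 1 := by
        rw [← Complex.ofReal_one, ← Complex.ofReal_sub, Complex.norm_real,
          Real.norm_of_nonneg (by linarith [ht.2])]
        linarith [ht.1]
      have h2 : ‖Complex.exp (l * t * y * Complex.I)‖ = 1 := by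
        rw [← Complex.norm_exp_ofReal_mul_I (l * t * y)]; push_cast; rfl
      have h3 : ‖G (ε + l * t * Complex.I)‖ ≤ M := by
        refine hM _ (Complex.mem_reProdIm.2 ⟨?_, ?_⟩)
        · simpa using ⟨hε.1.le, hε.2.le⟩
        · simp only [Complex.add_im, Complex.ofReal_im, Complex.mul_im, Complex.mul_re,
            Complex.ofReal_re, Complex.I_im, Complex.I_re, mem_Icc]
          constructor <;> nlinarith [ht.1, ht.2]
      rw [norm_mul, norm_mul, h2, mul_one]
      simpa using mul_le_mul h1 h3 (norm_nonneg _) zero_le_one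
    · refine ae_of_all _ fun t _ => ?_
      refine tendsto_const_nhds.mul ?_
      have hc : ContinuousOn (fun ε : ℝ => G (ε + l * t * Complex.I)) (Ici 0) :=
        hGc.comp (by fun_prop) fun ε hε => by simpa using hε
      have := (hc 0 self_mem_Ici).tendsto.mono_left (nhdsWithin_mono _ Ioi_subset_Ici_self)
      simpa using this
  refine tendsto_nhds_unique hL (Tendsto.congr' ?_ ((Complex.continuous_re.tendsto _).comp hR))
  filter_upwards [self_mem_nhdsWithin] with ε hε
  exact (integral_mul_exp_mul_fejer hm hC hG hε l y).symm

/-- The kernel's transform has compact support, so only `G` on a bounded segment of the imaginary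
axis enters, and Riemann–Lebesgue applies with frequency proportional to `y`. -/
theorem tendsto_integral_mul_fejer_zero {h : ℝ → ℝ} {C : ℝ} (hm : Measurable h)
    (hC : ∀ u, |h u| ≤ C) {G : ℂ → ℂ} (hGc : ContinuousOn G {z | 0 ≤ z.re})
    (hG : ∀ z : ℂ, 0 < z.re → ∫ u in Ioi (0 : ℝ), (h u : ℂ) * Complex.exp (-z * u) = G z)
    {l : ℝ} (hl : 0 < l) :
    Tendsto (fun y => ∫ u in Ioi (0 : ℝ), h u * fejer (l * (y - u))) atTop (𝓝 0) := by
  simp_rw [integral_mul_fejer_eq hm hC hGc hG hl]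
  have hRL := Real.tendsto_integral_exp_smul_cocompact
    ((Ioc (0 : ℝ) 1).indicator fun t : ℝ => (1 - t : ℂ) * G (l * t * Complex.I))
  -- The factor `-(l / 2π)` converts Mathlib's `exp (-2πi t w)` into `exp (i l t y)`.
  have hy : Tendsto (fun y : ℝ => -(l / (2 * Real.pi)) * y) atTop (cocompact ℝ) := by
    refine Tendsto.mono_right ?_ atBot_le_cocompact
    exact tendsto_id.const_mul_atTop_of_neg (by have := Real.pi_pos; simp; positivity)
  have h0 := (Complex.continuous_re.tendsto 0).comp (hRL.comp hy)
  rw [Complex.zero_re] at h0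
  refine h0.congr fun y => ?_
  simp only [Function.comp_apply]
  rw [intervalIntegral.integral_of_le zero_le_one, ← integral_indicator measurableSet_Ioc]
  congr 2
  ext t
  by_cases ht : t ∈ Ioc (0 : ℝ) 1
  · rw [indicator_of_mem ht, indicator_of_mem ht, Circle.smul_def, Real.fourierChar_apply,
      smul_eq_mul]
    have : ((2 * Real.pi * -(t * (-(l / (2 * Real.pi)) * y)) : ℝ) : ℂ) * Complex.I =
        l * t * y * Complex.I := by
      have hpi := Real.pi_ne_zero
      rw [show 2 * Real.pi * -(t * (-(l / (2 * Real.pi)) * y)) = l * t * y by field_simp]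
      push_cast; rfl
    rw [this]; ring
  · rw [indicator_of_notMem ht, indicator_of_notMem ht, smul_zero]

theorem tendsto_integral_fejer {l : ℝ} (hl : 0 < l) :
    Tendsto (fun y => ∫ u in Ioi (0 : ℝ), fejer (l * (y - u))) atTop
      (𝓝 (l⁻¹ * ∫ w, fejer w)) := by
  have hi : Integrable fun v => fejer (l * v) := integrable_fejer.comp_mul_left' hl.ne'
  have h1 : Tendsto (fun y => ∫ v in Iio y, fejer (l * v)) atTop (𝓝 (∫ v, fejer (l * v))) :=
    (aecover_Iio tendsto_id).integral_tendsto_of_countably_generated hi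
  rw [Measure.integral_comp_mul_left, abs_of_pos (inv_pos.2 hl), smul_eq_mul] at h1
  refine h1.congr fun y => ?_
  rw [← integral_indicator measurableSet_Iio, ← integral_indicator measurableSet_Ioi,
    ← integral_sub_left_eq_self _ volume y]
  congr 1
  ext u
  simp [indicator]

/-- Restoring the constant `1` to `f - 1` adds the kernel's full mass; the substitution `w = l (y -
u)` then displays an average of `f` at scale `1 / l`. -/
theorem tendsto_integral_comp_sub_mul_fejer {f : ℝ → ℝ} {C : ℝ} (hm : Measurable f)
    (hf0 : ∀ u, 0 ≤ f u) (hfC : ∀ u, f u ≤ C) (hneg : ∀ u ≤ 0, f u = 0)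
    {G : ℂ → ℂ} (hGc : ContinuousOn G {z | 0 ≤ z.re})
    (hG : ∀ z : ℂ, 0 < z.re →
      ∫ u in Ioi (0 : ℝ), ((f u - 1 : ℝ) : ℂ) * Complex.exp (-z * u) = G z)
    {l : ℝ} (hl : 0 < l) :
    Tendsto (fun y => ∫ w, f (y - w / l) * fejer w) atTop (𝓝 (∫ w, fejer w)) := by
  have hb : ∀ u, |f u - 1| ≤ C + 1 := fun u => by
    rw [abs_le]; constructor <;> linarith [hf0 u, hfC u]
  have h1 := ((tendsto_integral_mul_fejer_zero (h := fun u => f u - 1) (by fun_prop) hb hGc hG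
    hl).add (tendsto_integral_fejer hl)).const_mul l
  rw [zero_add, mul_inv_cancel_left₀ hl.ne'] at h1
  refine h1.congr fun y => ?_
  have hK := integrable_fejer_comp hl y
  have hfK : Integrable fun u => (f u - 1) * fejer (l * (y - u)) :=
    hK.bdd_mul (c := C + 1) (by fun_prop) (ae_of_all _ hb)
  rw [← integral_add hfK.integrableOn hK.integrableOn]
  have h2 : ∫ u in Ioi (0 : ℝ), ((f u - 1) * fejer (l * (y - u)) + fejer (l * (y - u))) =
      ∫ u, f u * fejer (l * (y - u)) := by
    rw [← integral_indicator measurableSet_Ioi]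
    congr 1
    ext u
    by_cases hu : 0 < u
    · rw [indicator_of_mem (mem_Ioi.2 hu)]; ring
    · rw [indicator_of_notMem (by simpa using hu), hneg u (not_lt.1 hu), zero_mul]
  rw [h2, ← integral_sub_left_eq_self _ volume y]
  have h3 := Measure.integral_comp_mul_left (fun w => f (y - w / l) * fejer w) l
  rw [abs_of_pos (inv_pos.2 hl), smul_eq_mul] at h3
  rw [← mul_inv_cancel_left₀ hl.ne' (∫ w, f (y - w / l) * fejer w), ← h3]
  congr 2
  ext v
  rw [mul_div_cancel_left₀ _ hl.ne', sub_sub_cancel]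

/-- Monotonicity of `e^u f(u)` prevents `f` from dropping quickly, so averages over short windows
control point values. The kernel's tail is discarded using `0 ≤ f` for the upper bound, and costs at
most `C * s` for the lower one. -/
theorem tendsto_one_of_laplace {f : ℝ → ℝ} {C : ℝ} (hm : Measurable f)
    (hf0 : ∀ u, 0 ≤ f u) (hfC : ∀ u, f u ≤ C) (hneg : ∀ u ≤ 0, f u = 0)
    (hmono : Monotone fun u => Real.exp u * f u)
    {G : ℂ → ℂ} (hGc : ContinuousOn G {z | 0 ≤ z.re})
    (hG : ∀ z : ℂ, 0 < z.re →
      ∫ u in Ioi (0 : ℝ), ((f u - 1 : ℝ) : ℂ) * Complex.exp (-z * u) = G z) :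
    Tendsto f atTop (𝓝 1) := by
  set κ := ∫ w, fejer w with hκ
  have hκ0 : 0 < κ := integral_fejer_pos
  have hC0 : 0 ≤ C := (hf0 0).trans (hfC 0)
  have hstep : ∀ u v, u ≤ v → f u ≤ Real.exp (v - u) * f v := fun u v huv => by
    have := hmono huv
    simp only at this
    rw [Real.exp_sub, div_mul_eq_mul_div, le_div_iff₀ (Real.exp_pos u)]
    linarith
  have hint : ∀ l y, Integrable fun w => f (y - w / l) * fejer w := fun l y =>
    integrable_fejer.bdd_mul (c := C) (hm.comp (by fun_prop)).aestronglyMeasurable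
      (ae_of_all _ fun w => by rw [Real.norm_of_nonneg (hf0 _)]; exact hfC _)
  -- Both bounds at scale `s`: average over a window on which `f` varies by at most `exp (2 s)`.
  have key : ∀ s : ℝ, 0 < s → s < κ → ∀ᶠ y in atTop,
      f (y - s) ≤ Real.exp (2 * s) * ((κ + s) / (κ - s)) ∧
      κ - s - C * s ≤ Real.exp (2 * s) * f (y + s) * κ := by
    intro s hs hsκ
    have hlim : Tendsto (fun A : ℝ => ∫ w in Icc (-A) A, fejer w) atTop (𝓝 κ) :=
      (aecover_Icc tendsto_neg_atTop_atBot tendsto_id).integral_tendsto_of_countably_generated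
        integrable_fejer
    obtain ⟨A, hA, hA0⟩ := ((hlim.eventually (lt_mem_nhds (show κ - s < κ by linarith))).and
      (eventually_gt_atTop 0)).exists
    have hcompl : (∫ w in Icc (-A) A, fejer w) + ∫ w in (Icc (-A) A)ᶜ, fejer w = κ :=
      integral_add_compl measurableSet_Icc integrable_fejer
    have hcompl0 : 0 ≤ ∫ w in (Icc (-A) A)ᶜ, fejer w :=
      integral_nonneg fejer_nonneg
    -- This scale shrinks `[-A, A]`, which carries all but `s` of the kernel's mass, to the window
    -- `|w / l| ≤ s`.
    set l := A / s with hl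
    have hl0 : 0 < l := by positivity
    have hlA : A / l = s := by rw [hl]; field_simp
    have hwin : ∀ w ∈ Icc (-A) A, -s ≤ w / l ∧ w / l ≤ s := fun w hw => by
      rw [← hlA, ← neg_div]
      exact ⟨div_le_div_of_nonneg_right hw.1 hl0.le, div_le_div_of_nonneg_right hw.2 hl0.le⟩
    have hT := tendsto_integral_comp_sub_mul_fejer hm hf0 hfC hneg hGc hG hl0
    filter_upwards [hT.eventually (lt_mem_nhds (show κ - s < κ by linarith)),
      hT.eventually (gt_mem_nhds (show κ < κ + s by linarith))] with y hy1 hy2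
    have hsplit : (∫ w in Icc (-A) A, f (y - w / l) * fejer w) +
        ∫ w in (Icc (-A) A)ᶜ, f (y - w / l) * fejer w = ∫ w, f (y - w / l) * fejer w :=
      integral_add_compl measurableSet_Icc (hint l y)
    have hexp : Real.exp (2 * s) = Real.exp s * Real.exp s := by rw [← Real.exp_add]; ring_nf
    constructor
    · have h1 : f (y - s) * Real.exp (-(2 * s)) * ∫ w in Icc (-A) A, fejer w ≤
          ∫ w in Icc (-A) A, f (y - w / l) * fejer w := by
        rw [← integral_const_mul]
        refine setIntegral_mono_on (integrable_fejer.const_mul _).integrableOn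
          (hint l y).integrableOn measurableSet_Icc fun w hw => ?_
        refine mul_le_mul_of_nonneg_right ?_ (fejer_nonneg w)
        obtain ⟨hw1, hw2⟩ := hwin w hw
        rw [Real.exp_neg, ← div_eq_mul_inv, div_le_iff₀ (Real.exp_pos _), mul_comm]
        refine (hstep (y - s) (y - w / l) (by linarith)).trans ?_
        exact mul_le_mul_of_nonneg_right (Real.exp_le_exp.2 (by linarith)) (hf0 _)
      have h2 : 0 ≤ ∫ w in (Icc (-A) A)ᶜ, f (y - w / l) * fejer w :=
        integral_nonneg fun w => mul_nonneg (hf0 _) (fejer_nonneg w)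
      have h3 : f (y - s) * Real.exp (-(2 * s)) * (κ - s) ≤ κ + s :=
        (mul_le_mul_of_nonneg_left hA.le (mul_nonneg (hf0 _) (Real.exp_nonneg _))).trans
          (by linarith)
      rw [← le_div_iff₀ (by linarith), Real.exp_neg, ← div_eq_mul_inv,
        div_le_iff₀ (Real.exp_pos _)] at h3
      linarith
    · have h1 : ∫ w in Icc (-A) A, f (y - w / l) * fejer w ≤
          Real.exp (2 * s) * f (y + s) * ∫ w in Icc (-A) A, fejer w := by
        rw [← integral_const_mul]
        refine setIntegral_mono_on (hint l y).integrableOn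
          (integrable_fejer.const_mul _).integrableOn measurableSet_Icc fun w hw => ?_
        refine mul_le_mul_of_nonneg_right ?_ (fejer_nonneg w)
        obtain ⟨hw1, hw2⟩ := hwin w hw
        refine (hstep (y - w / l) (y + s) (by linarith)).trans ?_
        exact mul_le_mul_of_nonneg_right (Real.exp_le_exp.2 (by linarith)) (hf0 _)
      have h2 : ∫ w in (Icc (-A) A)ᶜ, f (y - w / l) * fejer w ≤
          C * ∫ w in (Icc (-A) A)ᶜ, fejer w := by
        rw [← integral_const_mul]
        exact integral_mono (hint l y).integrableOn (integrable_fejer.const_mul _).integrableOn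
          fun w => mul_le_mul_of_nonneg_right (hfC _) (fejer_nonneg w)
      have h3 : C * ∫ w in (Icc (-A) A)ᶜ, fejer w ≤ C * s :=
        mul_le_mul_of_nonneg_left (by linarith) hC0
      have h4 : Real.exp (2 * s) * f (y + s) * ∫ w in Icc (-A) A, fejer w ≤
          Real.exp (2 * s) * f (y + s) * κ :=
        mul_le_mul_of_nonneg_left (by linarith) (mul_nonneg (Real.exp_nonneg _) (hf0 _))
      linarith
  have hpos : ∀ᶠ s in 𝓝[>] (0 : ℝ), 0 < s ∧ s < κ := Ioo_mem_nhdsGT hκ0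
  -- As `s → 0⁺` both bounds in `key` tend to `1`, so a small enough `s` settles each inequality.
  refine tendsto_order.2 ⟨fun a ha => ?_, fun a ha => ?_⟩
  · have hc : ContinuousAt (fun s : ℝ => Real.exp (2 * s) * a * κ + s + C * s) 0 := by fun_prop
    have hlt : ∀ᶠ s in 𝓝[>] (0 : ℝ), Real.exp (2 * s) * a * κ + s + C * s < κ :=
      nhdsWithin_le_nhds (hc.eventually (gt_mem_nhds (by simpa using mul_lt_of_lt_one_left hκ0 ha)))
    obtain ⟨s, ⟨hs, hsκ⟩, hlt⟩ := (hpos.and hlt).exists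
    filter_upwards [(tendsto_atTop_add_const_right atTop (-s) tendsto_id).eventually (key s hs hsκ)]
      with y hy
    have h1 := hy.2
    simp only [id, neg_add_cancel_right] at h1
    have h2 : Real.exp (2 * s) * a * κ < Real.exp (2 * s) * f y * κ := by linarith
    exact lt_of_mul_lt_mul_left (lt_of_mul_lt_mul_right h2 hκ0.le) (Real.exp_nonneg _)
  · have hc : ContinuousAt (fun s : ℝ => Real.exp (2 * s) * ((κ + s) / (κ - s))) 0 := by
      have : κ - 0 ≠ 0 := by simpa using hκ0.ne'
      fun_prop (disch := assumption)
    have hlt : ∀ᶠ s in 𝓝[>] (0 : ℝ), Real.exp (2 * s) * ((κ + s) / (κ - s)) < a :=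
      nhdsWithin_le_nhds (hc.eventually (gt_mem_nhds (by simpa [hκ0.ne'] using ha)))
    obtain ⟨s, ⟨hs, hsκ⟩, hlt⟩ := (hpos.and hlt).exists
    filter_upwards [(tendsto_atTop_add_const_right atTop s tendsto_id).eventually (key s hs hsκ)]
      with y hy
    have h1 := hy.1
    simp only [id, add_sub_cancel_right] at h1
    linarith

end WienerIkehara

/-! ### The prime number theorem: from `ψ` to `θ` to `π`. -/

namespace PrimeNumberTheorem

open Filter Topology MeasureTheory Set
open ArithmeticFunction Chebyshev

/-- Modulus `1` has a single residue class, so the results on primes in progressions specialise to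
`-ζ'/ζ`. -/
theorem residueClass_one_eq : vonMangoldt.residueClass (1 : ZMod 1) = fun n => vonMangoldt n := by
  ext n
  simp [vonMangoldt.residueClass, Subsingleton.elim (n : ZMod 1) 1]

theorem sum_vonMangoldt_isBigO :
    (fun n : ℕ => ∑ k ∈ Finset.Icc 1 n, vonMangoldt k) =O[atTop] fun n : ℕ => (n : ℝ) ^ (1 : ℝ) := by
  refine Asymptotics.IsBigO.of_bound (Real.log 4 + 4) (Eventually.of_forall fun n => ?_)
  have h : ∑ k ∈ Finset.Icc 1 n, vonMangoldt k = psi n := by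
    rw [psi, Nat.floor_natCast]; rfl
  rw [h, Real.rpow_one, Real.norm_of_nonneg (psi_nonneg _), Real.norm_natCast]
  exact psi_le_const_mul_self n.cast_nonneg

/-- `∫ (e^{-u} ψ(e^u) - 1) e^{-zu} du` continues continuously to `Re z ≥ 0`. -/
theorem laplace_psi {z : ℂ} (hz : 0 < z.re) :
    ∫ u in Ioi (0 : ℝ), ((Real.exp (-u) * psi (Real.exp u) - 1 : ℝ) : ℂ) * Complex.exp (-z * u) =
      (vonMangoldt.LFunctionResidueClassAux (1 : ZMod 1) (1 + z) - 1) / (1 + z) := by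
  have hz0 : z ≠ 0 := fun h => by simp [h] at hz
  have hs : 1 < (1 + z).re := by simpa using hz
  have hs0 : 1 + z ≠ 0 := fun h => by rw [h] at hs; simp at hs; linarith
  have hAux := vonMangoldt.eqOn_LFunctionResidueClassAux (a := (1 : ZMod 1)) isUnit_one hs
  have hL := LSeries_eq_mul_integral_of_nonneg (fun n => vonMangoldt n) zero_le_one hs
    sum_vonMangoldt_isBigO fun _ => vonMangoldt_nonneg
  have hexp : ∫ u in Ioi (0 : ℝ), Complex.exp (-z * u) = 1 / z := by
    rw [integral_exp_mul_complex_Ioi (by simpa using hz)]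
    simp [neg_div_neg_eq]
  -- Substituting `t = e^u` turns the Abel summation integral into a Laplace transform.
  have hpsi : ∫ t in Ioi (1 : ℝ), (∑ k ∈ Finset.Icc 1 ⌊t⌋₊, (vonMangoldt k : ℂ)) *
      (t : ℂ) ^ (-(1 + z + 1)) = ∫ u in Ioi (0 : ℝ),
      ((Real.exp (-u) * psi (Real.exp u) : ℝ) : ℂ) * Complex.exp (-z * u) := by
    have himg : Real.exp '' Ioi 0 = Ioi 1 := by
      ext t
      simp only [mem_image, mem_Ioi]
      constructor
      · rintro ⟨u, hu, rfl⟩; exact Real.one_lt_exp_iff.2 hu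
      · intro ht; exact ⟨Real.log t, Real.log_pos ht, Real.exp_log (by linarith)⟩
    rw [← himg, integral_image_eq_integral_abs_deriv_smul measurableSet_Ioi
      (fun u _ => (Real.hasDerivAt_exp u).hasDerivWithinAt) Real.exp_injective.injOn]
    refine setIntegral_congr_fun measurableSet_Ioi fun u _ => ?_
    have h1 : ∑ k ∈ Finset.Icc 1 ⌊Real.exp u⌋₊, (vonMangoldt k : ℂ) = (psi (Real.exp u) : ℂ) := by
      rw [psi]; push_cast; rfl
    have h2 : ((Real.exp u : ℝ) : ℂ) ^ (-(1 + z + 1)) = Complex.exp (-(1 + z + 1) * u) := by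
      rw [Complex.cpow_def_of_ne_zero (by exact_mod_cast (Real.exp_pos u).ne'),
        ← Complex.ofReal_log (Real.exp_nonneg u), Real.log_exp, mul_comm]
    simp only [h1, h2, abs_of_pos (Real.exp_pos u), Complex.real_smul]
    push_cast
    have h3 : Complex.exp u * Complex.exp (-(1 + z + 1) * u) =
        Complex.exp (-u) * Complex.exp (-z * u) := by
      rw [← Complex.exp_add, ← Complex.exp_add]; ring_nf
    linear_combination (psi (Real.exp u) : ℂ) * h3
  rw [hpsi] at hL
  have hint1 : IntegrableOn (fun u : ℝ => Complex.exp (-z * u)) (Ioi 0) :=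
    integrableOn_exp_mul_complex_Ioi (by simpa using hz) 0
  have hint2 : IntegrableOn (fun u : ℝ => ((Real.exp (-u) * psi (Real.exp u) : ℝ) : ℂ) *
      Complex.exp (-z * u)) (Ioi 0) := by
    have hmeas : Measurable psi := psi_mono.measurable
    refine hint1.bdd_mul (c := Real.log 4 + 4)
      (Measurable.aestronglyMeasurable (by fun_prop)) (ae_of_all _ fun u => ?_)
    rw [Complex.norm_real, Real.norm_of_nonneg (mul_nonneg (Real.exp_nonneg _) (psi_nonneg _)),
      Real.exp_neg, inv_mul_eq_div, div_le_iff₀ (Real.exp_pos u)]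
    exact psi_le_const_mul_self (Real.exp_nonneg u)
  have hsub : ∫ u in Ioi (0 : ℝ), ((Real.exp (-u) * psi (Real.exp u) - 1 : ℝ) : ℂ) *
      Complex.exp (-z * u) = (∫ u in Ioi (0 : ℝ),
      ((Real.exp (-u) * psi (Real.exp u) : ℝ) : ℂ) * Complex.exp (-z * u)) - 1 / z := by
    rw [← hexp, ← integral_sub hint2 hint1]
    congr 1
    ext u
    push_cast
    ring
  -- With `s = 1 + z` the pole cancels: `(Aux + 1/z)/s - 1/z = (Aux - 1)/s`.
  rw [hsub, hAux, residueClass_one_eq]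
  simp only [hL, Nat.totient_one, Nat.cast_one, inv_one, add_sub_cancel_left]
  field_simp
  ring

theorem tendsto_psi_div : Tendsto (fun x => psi x / x) atTop (𝓝 1) := by
  have hmeas : Measurable psi := psi_mono.measurable
  have hc : ContinuousOn (fun z : ℂ =>
      (vonMangoldt.LFunctionResidueClassAux (1 : ZMod 1) (1 + z) - 1) / (1 + z))
      {z | 0 ≤ z.re} := by
    refine ContinuousOn.div (((vonMangoldt.continuousOn_LFunctionResidueClassAux
      (1 : ZMod 1)).comp (by fun_prop) fun z hz => ?_).sub continuousOn_const) (by fun_prop)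
      fun z hz h => ?_
    · simpa using hz
    · have := congrArg Complex.re h
      simp at this hz
      linarith
  have h := WienerIkehara.tendsto_one_of_laplace (C := Real.log 4 + 4)
    (f := fun u => Real.exp (-u) * psi (Real.exp u)) (by fun_prop)
    (fun u => mul_nonneg (Real.exp_nonneg _) (psi_nonneg _)) (fun u => ?_) (fun u hu => ?_) ?_ hc
    fun z hz => laplace_psi hz
  · refine (h.comp Real.tendsto_log_atTop).congr' ?_
    filter_upwards [eventually_gt_atTop 0] with x hx
    simp only [Function.comp_apply, Real.exp_neg, Real.exp_log hx]
    rw [inv_mul_eq_div]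
  · rw [Real.exp_neg, inv_mul_eq_div, div_le_iff₀ (Real.exp_pos u)]
    exact psi_le_const_mul_self (Real.exp_nonneg u)
  · rw [psi_eq_zero_of_le_one (Real.exp_le_one_iff.2 hu), mul_zero]
  · intro u v huv
    simp only [← mul_assoc, ← Real.exp_add, add_neg_cancel, Real.exp_zero, one_mul]
    exact psi_mono (Real.exp_le_exp.2 huv)

theorem tendsto_theta_div : Tendsto (fun x => theta x / x) atTop (𝓝 1) := by
  have h1 : (fun x : ℝ => Real.sqrt x) =o[atTop] fun x : ℝ => x := by
    refine (Asymptotics.isLittleO_iff_tendsto' ?_).2 ?_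
    · filter_upwards [eventually_gt_atTop 0] with x hx h
      exact absurd h hx.ne'
    · refine Real.tendsto_sqrt_atTop.inv_tendsto_atTop.congr' ?_
      filter_upwards [eventually_gt_atTop 0] with x hx
      rw [Pi.inv_apply, Real.sqrt_div_self', one_div]
  have h2 := (isBigO_psi_sub_theta_sqrt.trans_isLittleO h1).tendsto_div_nhds_zero
  have h3 := tendsto_psi_div.sub h2
  rw [sub_zero] at h3
  refine h3.congr fun x => ?_
  simp only [Pi.sub_apply]
  ring

/-- The prime number theorem. -/
theorem tendsto_primeCounting_mul_log_div :
    Tendsto (fun n : ℕ => (Nat.primeCounting n : ℝ) * Real.log n / n) atTop (𝓝 1) := by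
  -- The error in `π(x) ≈ θ(x) / log x` is `O(x / log² x)`, hence of lower order than `x / log x`.
  have h1 : (fun x : ℝ => x / Real.log x ^ 2) =o[atTop] fun x : ℝ => x / Real.log x := by
    refine (Asymptotics.isLittleO_iff_tendsto' ?_).2 ?_
    · filter_upwards [eventually_gt_atTop 1] with x hx h
      have := Real.log_pos hx
      have : 0 < x / Real.log x := by positivity
      linarith
    · refine Real.tendsto_log_atTop.inv_tendsto_atTop.congr' ?_
      filter_upwards [eventually_gt_atTop 1] with x hx
      have := Real.log_pos hx
      simp only [Pi.inv_apply]
      field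
  have h2 := (primeCounting_sub_theta_div_log_isBigO.trans_isLittleO h1).tendsto_div_nhds_zero
  have h3 := (h2.add tendsto_theta_div).comp tendsto_natCast_atTop_atTop
  rw [zero_add] at h3
  refine h3.congr' ?_
  filter_upwards [eventually_gt_atTop 1] with n hn
  have hn' : (1 : ℝ) < n := by exact_mod_cast hn
  have := Real.log_pos hn'
  simp only [Function.comp_apply, Nat.floor_natCast]
  field_simp
  ring

end PrimeNumberTheorem

/-! ### Fourier analysis on `ZMod n` and the prime pair counts. -/

namespace PrimePairs

open Filter Topology

theorem rep_natCast {n m : ℕ} (hm : m ∈ Finset.Icc 1 n) : rep n (m : ZMod n) = m := by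
  obtain ⟨h1, h2⟩ := Finset.mem_Icc.1 hm
  unfold rep
  split_ifs with h
  · exact le_antisymm (Nat.le_of_dvd h1 ((ZMod.natCast_eq_zero_iff m n).1 h)) h2
  · refine ZMod.val_cast_of_lt (lt_of_le_of_ne h2 ?_)
    rintro rfl
    exact h (ZMod.natCast_self m)

theorem sum_eq_sum_Icc {M : Type*} [AddCommMonoid M] (n : ℕ) [NeZero n] (g : ZMod n → M) :
    ∑ x, g x = ∑ m ∈ Finset.Icc 1 n, g m :=
  Finset.sum_bij' (fun x _ => rep n x) (fun m _ => (m : ZMod n)) (fun x _ => rep_mem n x)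
    (fun _ _ => Finset.mem_univ _) (fun x _ => rep_cast n x) (fun _ hm => rep_natCast hm)
    (fun x _ => by rw [rep_cast])

theorem primeInd_natCast {n m : ℕ} (hm : m ∈ Finset.Icc 1 n) :
    primeInd n (m : ZMod n) = if m.Prime then 1 else 0 := by
  rw [primeInd, rep_natCast hm]

theorem conj_primeInd (n : ℕ) (x : ZMod n) : (starRingEnd ℂ) (primeInd n x) = primeInd n x := by
  unfold primeInd; split_ifs <;> simp

theorem norm_primeInd_le (n : ℕ) (x : ZMod n) : ‖primeInd n x‖ ≤ 1 := by
  unfold primeInd; split_ifs <;> simp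

/-- The Wiener–Khinchin identity on `ℤ/nℤ` for a real-valued function. -/
theorem sum_norm_dft_sq_mul_stdAddChar {n : ℕ} [NeZero n] {f : ZMod n → ℂ}
    (hf : ∀ x, (starRingEnd ℂ) (f x) = f x) (c : ZMod n) :
    ∑ ξ, (‖ZMod.dft f ξ‖ : ℂ) ^ 2 * ZMod.stdAddChar (-(c * ξ)) = n * ∑ y, f y * f (y + c) := by
  have hinv : ∀ y, ∑ ξ, ZMod.stdAddChar (ξ * y) * ZMod.dft f ξ = n * f y := fun y => by
    have h := ZMod.invDFT_apply (ZMod.dft f) y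
    rw [LinearEquiv.symm_apply_apply] at h
    rw [h]
    simp only [smul_eq_mul]
    rw [mul_inv_cancel_left₀ (NeZero.ne (n : ℂ))]
  have hconj : ∀ ξ, (starRingEnd ℂ) (ZMod.dft f ξ) = ∑ y, ZMod.stdAddChar (y * ξ) * f y :=
    fun ξ => by
      rw [ZMod.dft_apply, map_sum]
      refine Finset.sum_congr rfl fun y _ => ?_
      rw [smul_eq_mul, map_mul, hf, ← AddChar.map_neg_eq_conj, neg_neg]
  -- In `|f̂|² = conj f̂ · f̂` only the conjugate factor is expanded; summing over `ξ` then inverts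
  -- the other at `y - c`.
  have hterm : ∀ ξ, (‖ZMod.dft f ξ‖ : ℂ) ^ 2 * ZMod.stdAddChar (-(c * ξ)) =
      ∑ y, f y * (ZMod.stdAddChar (ξ * (y - c)) * ZMod.dft f ξ) := fun ξ => by
    rw [← Complex.mul_conj', hconj, Finset.mul_sum, Finset.sum_mul]
    refine Finset.sum_congr rfl fun y _ => ?_
    rw [show ξ * (y - c) = y * ξ + -(c * ξ) by ring, AddChar.map_add_eq_mul]
    ring
  simp_rw [hterm]
  rw [Finset.sum_comm]
  simp_rw [← Finset.mul_sum, hinv]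
  rw [← Equiv.sum_comp (Equiv.addRight c), Finset.mul_sum]
  refine Finset.sum_congr rfl fun y _ => ?_
  simp only [Equiv.coe_addRight, add_sub_cancel_right]
  ring

theorem cyclicPairCount_eq_sum (k n : ℕ) [NeZero n] :
    cyclicPairCount k n = ∑ y, primeInd n y * primeInd n (y + 2 * (k : ZMod n)) := by
  unfold cyclicPairCount conv
  refine Finset.sum_congr rfl fun y _ => ?_
  simp only [neg_sub, sub_neg_eq_add]

theorem cyclicPairCount_eq (k n : ℕ) [NeZero n] :
    cyclicPairCount k n = (1 / (n : ℂ)) * ∑ ξ, spectralTerm k n ξ := by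
  unfold spectralTerm primeHat
  rw [sum_norm_dft_sq_mul_stdAddChar (conj_primeInd n), ← cyclicPairCount_eq_sum, one_div,
    inv_mul_cancel_left₀ (NeZero.ne (n : ℂ))]

theorem primeHat_zero (n : ℕ) [NeZero n] : primeHat n 0 = Nat.primeCounting n := by
  rw [primeHat, ZMod.dft_apply_zero, sum_eq_sum_Icc,
    Finset.sum_congr rfl fun m hm => primeInd_natCast hm, Finset.sum_boole,
    Nat.primeCounting, Nat.primeCounting', Nat.count_eq_card_filter_range]
  congr 2
  ext m
  simp only [Finset.mem_filter, Finset.mem_Icc, Finset.mem_range]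
  constructor
  · rintro ⟨h, hp⟩; exact ⟨by lia, hp⟩
  · rintro ⟨h, hp⟩; exact ⟨⟨hp.one_lt.le, by lia⟩, hp⟩

theorem spectralTerm_zero (k n : ℕ) [NeZero n] :
    spectralTerm k n 0 = (Nat.primeCounting n : ℂ) ^ 2 := by
  simp [spectralTerm, primeHat_zero]

/-- The summands agree unless `m + 2k` exceeds `n` and wraps around, which leaves at most `2k`
values of `m`. -/
theorem norm_primePairCount_sub_le (k n : ℕ) [NeZero n] :
    ‖(primePairCount k n : ℂ) - cyclicPairCount k n‖ ≤ 2 * k := by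
  rw [cyclicPairCount_eq_sum, sum_eq_sum_Icc, primePairCount, ← Finset.sum_boole,
    ← Finset.sum_sub_distrib]
  have hcast : ∀ m : ℕ, (m : ZMod n) + 2 * (k : ZMod n) = ((m + 2 * k : ℕ) : ZMod n) := by
    intro m; push_cast; rfl
  have hle : ∀ m ∈ Finset.Icc 1 n, ‖(if m.Prime ∧ (m + 2 * k).Prime then (1 : ℂ) else 0) -
      primeInd n m * primeInd n (m + 2 * (k : ZMod n))‖ ≤ if n < m + 2 * k then (1 : ℝ) else 0 := by
    intro m hm
    have hm' := Finset.mem_Icc.1 hm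
    rw [hcast, primeInd_natCast hm]
    by_cases hmk : n < m + 2 * k
    · rw [if_pos hmk, primeInd]
      split_ifs <;> simp
    · rw [if_neg hmk, primeInd_natCast (Finset.mem_Icc.2 ⟨by lia, not_lt.1 hmk⟩)]
      split_ifs <;> simp_all
  refine (norm_sum_le_of_le _ hle).trans ?_
  rw [Finset.sum_boole]
  -- Truncated subtraction makes this cover `n < 2k` as well.
  have hsub : (Finset.Icc 1 n).filter (fun m => n < m + 2 * k) ⊆ Finset.Ioc (n - 2 * k) n := by
    intro m hm
    simp only [Finset.mem_filter, Finset.mem_Icc] at hm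
    rw [Finset.mem_Ioc]
    lia
  have hcard := Finset.card_le_card hsub
  rw [Nat.card_Ioc] at hcard
  exact_mod_cast hcard.trans (by lia)

/-- Divided by `n / log² n`, the difference is `(π(n) log n / n)² - 1`. -/
theorem primeCounting_sq_div_sub_isLittleO :
    (fun n : ℕ => (Nat.primeCounting n : ℝ) ^ 2 / n - n / Real.log n ^ 2)
      =o[atTop] fun n : ℕ => (n : ℝ) / Real.log n ^ 2 := by
  have h := (PrimeNumberTheorem.tendsto_primeCounting_mul_log_div.pow 2).sub_const 1
  rw [one_pow, sub_self] at h
  have hpos : ∀ᶠ n : ℕ in atTop, 0 < (n : ℝ) ∧ 0 < Real.log n := by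
    filter_upwards [eventually_gt_atTop 1] with n hn
    exact ⟨by positivity, Real.log_pos (by exact_mod_cast hn)⟩
  refine (Asymptotics.isLittleO_iff_tendsto' ?_).2 (h.congr' ?_)
  · filter_upwards [hpos] with n ⟨hn, hl⟩ h0
    have : 0 < (n : ℝ) / Real.log n ^ 2 := by positivity
    exact absurd h0 this.ne'
  · filter_upwards [hpos] with n ⟨hn, hl⟩
    field

theorem cyclicPairCount_sub_isLittleO (k : ℕ) :
    (fun n : ℕ+ => cyclicPairCount k n -
        ((((n : ℕ) : ℝ) / Real.log ((n : ℕ) : ℝ) ^ 2 : ℝ) +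
          (1 / ((n : ℕ) : ℂ)) *
            ∑ ξ ∈ (Finset.univ : Finset (ZMod n)).erase 0, spectralTerm k n ξ))
      =o[atTop] fun n : ℕ+ => ((n : ℕ) : ℝ) / Real.log ((n : ℕ) : ℝ) ^ 2 := by
  have h := primeCounting_sq_div_sub_isLittleO.comp_tendsto tendsto_PNat_val_atTop_atTop
  refine (Asymptotics.IsLittleO.of_norm_left (h.norm_left.congr_left fun n => ?_))
  rw [cyclicPairCount_eq, ← Finset.add_sum_erase _ _ (Finset.mem_univ (0 : ZMod n)),
    spectralTerm_zero, ← Complex.norm_real]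
  simp only [Function.comp_apply]
  congr 1
  push_cast
  ring

theorem primePairCount_sub_cyclicPairCount_isBigO (k : ℕ) :
    (fun n : ℕ+ => (primePairCount k n : ℂ) - cyclicPairCount k n)
      =O[atTop] fun _ : ℕ+ => (1 : ℝ) :=
  Asymptotics.IsBigO.of_bound (2 * k) (Eventually.of_forall fun n => by
    simpa using norm_primePairCount_sub_le k n)

theorem one_isLittleO_div_log_sq :
    (fun _ : ℕ+ => (1 : ℝ)) =o[atTop] fun n : ℕ+ => ((n : ℕ) : ℝ) / Real.log ((n : ℕ) : ℝ) ^ 2 := by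
  have h : (fun _ : ℝ => (1 : ℝ)) =o[atTop] fun x : ℝ => x / Real.log x ^ 2 := by
    have h1 := (Real.isLittleO_pow_log_id_atTop (n := 2)).tendsto_div_nhds_zero
    refine (Asymptotics.isLittleO_iff_tendsto' ?_).2 (h1.congr fun x => ?_)
    · filter_upwards [eventually_gt_atTop 1] with x hx h0
      have := Real.log_pos hx
      have : 0 < x / Real.log x ^ 2 := by positivity
      exact absurd h0 this.ne'
    · rw [one_div_div, id]
  exact h.comp_tendsto (tendsto_natCast_atTop_atTop.comp tendsto_PNat_val_atTop_atTop)

end PrimePairs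

theorem theorem3p1 (k : ℕ) (hk : 0 < k) :
    -- the exact identity for the cyclic count `(P ∗ P₋)(-2k)`
    (∀ n : ℕ+, PrimePairs.cyclicPairCount k n =
      (1 / ((n : ℕ) : ℂ)) * ∑ ξ : ZMod n, PrimePairs.spectralTerm k n ξ) ∧
    -- the asymptotic form for the cyclic count
    ((fun n : ℕ+ => PrimePairs.cyclicPairCount k n -
        ((((n : ℕ) : ℝ) / Real.log ((n : ℕ) : ℝ) ^ 2 : ℝ) +
          (1 / ((n : ℕ) : ℂ)) *
            ∑ ξ ∈ (Finset.univ : Finset (ZMod n)).erase 0, PrimePairs.spectralTerm k n ξ))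
      =o[Filter.atTop] fun n : ℕ+ => ((n : ℕ) : ℝ) / Real.log ((n : ℕ) : ℝ) ^ 2) ∧
    -- the cyclic count is the prime pair count up to a bounded error
    ((fun n : ℕ+ => (PrimePairs.primePairCount k n : ℂ) - PrimePairs.cyclicPairCount k n)
      =O[Filter.atTop] fun _ : ℕ+ => (1 : ℝ)) ∧
    -- the asymptotic form for the prime pair count itself
    ((fun n : ℕ+ => (PrimePairs.primePairCount k n : ℂ) -
        ((((n : ℕ) : ℝ) / Real.log ((n : ℕ) : ℝ) ^ 2 : ℝ) +
          (1 / ((n : ℕ) : ℂ)) *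
            ∑ ξ ∈ (Finset.univ : Finset (ZMod n)).erase 0, PrimePairs.spectralTerm k n ξ))
      =o[Filter.atTop] fun n : ℕ+ => ((n : ℕ) : ℝ) / Real.log ((n : ℕ) : ℝ) ^ 2) := by
  have hO := PrimePairs.primePairCount_sub_cyclicPairCount_isBigO k
  have ho := PrimePairs.cyclicPairCount_sub_isLittleO k
  refine ⟨fun n => PrimePairs.cyclicPairCount_eq k n, ho, hO, ?_⟩
  refine ((hO.trans_isLittleO PrimePairs.one_isLittleO_div_log_sq).add ho).congr_left fun n => ?_
  exact sub_add_sub_cancel _ _ _
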